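/- **Theorem (freeness theorem).** For all $m,k\in\mathbb N$ there are $N,K\in\mathbb N$ such that, for every finite set $\Gamma$ of agents, every Cayley structure $\mathfrak M$ over $\Gamma$ that is $N$-acyclic and $K$-rich is $(m,k)$-free. Here the notions are as follows. *Cayley structures.* Let $G$ be a group generated by a set $E$ of non-trivial involutions, partitioned as $E=\dot\bigcup_{a\in\Gamma}E_a$. For $\alpha\subseteq\Gamma$ let $G_\alpha$ be the subgroup generated by $\bigcup_{a\in\alpha}E_a$, let $R_\alpha=\{(g,gh): g\in G,\ h\in G_\alpha\}$, and let $[w]_\alpha=wG_\alpha$ be the $R_\alpha$-class of $w$. The set $G$ of worlds with the equivalence relations $(R_\alpha)_{\alpha\subseteq\Gamma}$ is a Cayley frame; a Cayley structure $\mathfrak M$ is a Cayley frame together with a family $(P_i)_{i\in I}$ of subsets of $G$ (the propositional assignment). For worlds $v,w$ write $v\sim w$ if $\mathfrak M,v$ and $\mathfrak M,w$ are bisimilar with respect to the relations $R_\alpha$ and the predicates $P_i$. *Acyclicity.* A coset cycle of length $n\ge 2$ is a tuple $(w_i,\alpha_i)_{i\in\mathbb Z_n}$ of worlds $w_i$ and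 sets $\alpha_i\subseteq\Gamma$ with $(w_i,w_{i+1})\in R_{\alpha_i}$ and $[w_i]_{\alpha_{i-1}\cap\alpha_i}\cap[w_{i+1}]_{\alpha_i\cap\alpha_{i+1}}=\emptyset$ for all $i\in\mathbb Z_n$. $\mathfrak M$ is $N$-acyclic if it has no coset cycle of length at most $N$. If $\mathfrak M$ is $2$-acyclic, then for any worlds $v,w$ there is a least set $\mathrm{agt}(v,w)\subseteq\Gamma$ among the $\alpha$ with $(v,w)\in R_\alpha$. *Richness.* $\mathfrak M$ is $K$-rich if for every non-empty $\alpha\subseteq\Gamma$ and every world $w$ the class $[w]_\alpha$ contains at least $K$ worlds $v\sim w$. *Freeness.* The dual hypergraph $d(\mathfrak M)$ has as vertices the disjoint union over $\alpha\subseteq\Gamma$ of the sets $G/R_\alpha$ of $\alpha$-classes, and as hyperedges the sets $[\![w]\!]=\{[w]_\alpha:\alpha\subseteq\Gamma\}$ for $w\in G$. For sets $t,X,Y$ of vertices, $d_t(X,Y)\in\mathbb N\cup\{\infty\}$ is the distance between $X\setminus t$ and $Y\setminus t$ in the graph on the vertices outside $t$ in which two distinct vertices are adjacent if they lie in a common hyperedge.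 $\mathfrak M$ is $(m,k)$-free if it is $2$-acyclic and for every world $v$, every finite set $\mathbf z$ of worlds with $|\mathbf z|\le k$, every $z_0\in\mathbf z$ and every $\gamma\subseteq\Gamma$ with $\gamma\supseteq\mathrm{agt}(v,z_0)$, there is a world $v^*\sim v$ such that $\mathrm{agt}(v^*,z_0)=\gamma$ and $$d_t\Bigl(\bigcup_{z\in\mathbf z}[\![z]\!],\,[\![v^*]\!]\Bigr)>m\qquad\text{for } t=[\![v^*]\!]\cap[\![z_0]\!].$$ -/

import Mathlib

/-! ### Kripke structures and bisimulation -/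

/-- A Kripke structure with set of worlds `W`, accessibility relations indexed by `L` and
basic propositions indexed by `I`. -/
structure KripkeStructure (L I W : Type*) where
  /-- the accessibility relations -/
  rel : L → W → W → Prop
  /-- the propositional assignment -/
  val : I → Set W

namespace KripkeStructure

variable {L I W V : Type*}

/-- A bisimulation: a set of positions of the bisimulation game, each respecting propositional
equivalence, in which the second player can answer every challenge of the first player
(a move along an edge in either structure) without leaving the set. -/
structure IsBisimulation (A : KripkeStructure L I W) (B : KripkeStructure L I V)
    (Z : W → V → Prop) : Prop where
  atom : ∀ w v, Z w v → ∀ i, w ∈ A.val i ↔ v ∈ B.val i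
  forth : ∀ w v, Z w v → ∀ l w', A.rel l w w' → ∃ v', B.rel l v v' ∧ Z w' v'
  back : ∀ w v, Z w v → ∀ l v', B.rel l v v' → ∃ w', A.rel l w w' ∧ Z w' v'

/-- `A, w ∼ B, v`: the second player wins the unbounded bisimulation game from `(w, v)`. -/
def Bisimilar (A : KripkeStructure L I W) (w : W) (B : KripkeStructure L I V) (v : V) : Prop :=
  ∃ Z : W → V → Prop, IsBisimulation A B Z ∧ Z w v

end KripkeStructure

/-! ### Hypergraph distances -/

namespace Hypergraph

variable {A : Type*}

/-- The induced sub-hypergraph on the complement of `t`. -/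
def deleteVertices (H : Hypergraph A) (t : Set A) : Hypergraph A where
  vertexSet := H.vertexSet \ t
  edgeSet := (fun s => s \ t) '' H.edgeSet
  subset_vertexSet_of_mem_edgeSet' := by
    rintro _ ⟨s, hs, rfl⟩
    exact Set.sdiff_subset_sdiff_left (H.subset_vertexSet_of_mem_edgeSet' hs)

/-- The Gaifman graph links two distinct vertices if they lie in a common hyperedge. -/
def gaifman (H : Hypergraph A) : SimpleGraph A where
  Adj x y := x ≠ y ∧ H.Adj x y
  symm := ⟨fun _ _ h => ⟨h.1.symm, h.2.symm⟩⟩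
  loopless := ⟨fun _ h => h.1 rfl⟩

/-- `d_t(X, Y)`: the distance between `X \ t` and `Y \ t` in (the Gaifman graph of) the induced
sub-hypergraph on the complement of `t`. It is `⊤` if the two sets are not linked by any path,
in particular if one of them is empty. -/
noncomputable def distAvoiding (H : Hypergraph A) (t X Y : Set A) : ℕ∞ :=
  ⨅ x ∈ X \ t, ⨅ y ∈ Y \ t, (H.deleteVertices t).gaifman.edist x y

end Hypergraph

/-! ### Cayley frames and Cayley structures -/

/-- A Cayley group on `G` whose generator set, consisting of non-trivial involutions, is
partitioned into blocks `gens a` associated with the agents `a : Γ`. -/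
structure CayleyFrame (Γ G : Type*) [Group G] where
  /-- the generators associated with an agent -/
  gens : Γ → Set G
  ne_one : ∀ a, ∀ e ∈ gens a, e ≠ 1
  mul_self : ∀ a, ∀ e ∈ gens a, e * e = 1
  disjoint : ∀ a b, a ≠ b → Disjoint (gens a) (gens b)
  generates : Subgroup.closure (⋃ a, gens a) = ⊤

namespace CayleyFrame

variable {Γ G : Type*} [Group G] (F : CayleyFrame Γ G)

/-- The subgroup `G_α` generated by the generators of the agents in `α`. -/
def subgroup (α : Set Γ) : Subgroup G :=
  Subgroup.closure (⋃ a ∈ α, F.gens a)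

/-- The accessibility relation `R_α = {(g, gh) : h ∈ G_α}`. -/
def rel (α : Set Γ) (w v : G) : Prop :=
  w⁻¹ * v ∈ F.subgroup α

/-- The equivalence class (coset) `[w]_α`. -/
def cls (α : Set Γ) (w : G) : Set G :=
  {v | F.rel α w v}

/-- A coset cycle `(w_i, α_i)`, `i ∈ ℤ/n`, of length `n ≥ 2`. -/
structure IsCosetCycle (n : ℕ) (w : ZMod n → G) (α : ZMod n → Set Γ) : Prop where
  two_le : 2 ≤ n
  step : ∀ i, F.rel (α i) (w i) (w (i + 1))
  inter_eq_empty : ∀ i,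
    F.cls (α (i - 1) ∩ α i) (w i) ∩ F.cls (α i ∩ α (i + 1)) (w (i + 1)) = ∅

/-- There are no coset cycles of length up to `n`. -/
def IsAcyclic (n : ℕ) : Prop :=
  ∀ l ≤ n, ∀ (w : ZMod l → G) (α : ZMod l → Set Γ), ¬ F.IsCosetCycle l w α

/-- `agt(w, v)`, the minimal set of agents connecting `w` and `v` in a 2-acyclic frame, obtained
as the intersection of all connecting sets (see `isLeast_agt`). -/
def agt (w v : G) : Set Γ :=
  ⋂₀ {α | F.rel α w v}

/-- The vertices of the dual hypergraph: the disjoint union over `α` of the sets `W / R_α` of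
`α`-classes (left cosets of `G_α`). -/
abbrev DualVertex : Type _ :=
  Σ α : Set Γ, G ⧸ F.subgroup α

/-- The dual hyperedge `⟦w⟧ = {[w]_α : α ⊆ Γ}`. -/
def dualEdge (w : G) : Set F.DualVertex :=
  Set.range fun α : Set Γ => (⟨α, (w : G ⧸ F.subgroup α)⟩ : F.DualVertex)

/-- The dual hypergraph. -/
def dual : Hypergraph F.DualVertex where
  vertexSet := Set.univ
  edgeSet := Set.range F.dualEdge
  subset_vertexSet_of_mem_edgeSet' := fun _ _ => Set.subset_univ _

/-- `(Z, z₀) ⊥_m v`: the distance of `⋃ ⟦Z⟧` and `⟦v⟧` in the dual hypergraph exceeds `m` after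
removal of `t = ⟦v⟧ ∩ ⟦z₀⟧`. -/
def MFree (m : ℕ) (Z : Set G) (z₀ v : G) : Prop :=
  (m : ℕ∞) < F.dual.distAvoiding (F.dualEdge v ∩ F.dualEdge z₀)
    (⋃ z ∈ Z, F.dualEdge z) (F.dualEdge v)

variable {F} in
theorem rel_inter_of_isAcyclic_two (hF : F.IsAcyclic 2) {α β : Set Γ} {w v : G}
    (hα : F.rel α w v) (hβ : F.rel β w v) : F.rel (α ∩ β) w v := by
  have hβ' : F.rel β v w := by
    have := (F.subgroup β).inv_mem hβ
    simpa [rel] using this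
  have key : (F.cls (α ∩ β) w ∩ F.cls (α ∩ β) v).Nonempty := by
    by_contra hne
    rw [Set.not_nonempty_iff_eq_empty] at hne
    refine hF 2 le_rfl (![w, v] : Fin 2 → G) (![α, β] : Fin 2 → Set Γ) ⟨le_rfl, ?_, ?_⟩
    · intro i
      fin_cases i
      · exact hα
      · exact hβ'
    · intro i
      fin_cases i
      · change F.cls (β ∩ α) w ∩ F.cls (α ∩ β) v = ∅
        rwa [Set.inter_comm β α]
      · change F.cls (α ∩ β) v ∩ F.cls (β ∩ α) w = ∅
        rwa [Set.inter_comm β α, Set.inter_comm]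
  obtain ⟨u, hu, hu'⟩ := key
  have := (F.subgroup (α ∩ β)).mul_mem hu ((F.subgroup (α ∩ β)).inv_mem hu')
  simpa [rel] using this

variable {F} in
/-- In a 2-acyclic frame `agt w v` is the least set of agents that connects `w` and `v`. -/
theorem isLeast_agt [Finite Γ] (hF : F.IsAcyclic 2) (w v : G) :
    IsLeast {α | F.rel α w v} (F.agt w v) := by
  refine ⟨?_, fun α hα => Set.sInter_subset_of_mem hα⟩
  have huniv : F.rel Set.univ w v := by
    simp [rel, subgroup, F.generates]
  have hfin : ∀ S : Set (Set Γ), S.Finite → S ⊆ {α | F.rel α w v} → F.rel (⋂₀ S) w v := by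
    intro S hS
    induction S, hS using Set.Finite.induction_on with
    | empty => intro _; simpa using huniv
    | insert _ _ ih =>
      intro h
      rw [Set.sInter_insert]
      exact rel_inter_of_isAcyclic_two hF (h (Set.mem_insert _ _))
        (ih fun _ hx => h (Set.mem_insert_of_mem _ hx))
  exact hfin _ (Set.toFinite _) subset_rfl

end CayleyFrame

/-- A Cayley structure: a Cayley frame together with a propositional assignment. -/
structure CayleyStructure (Γ I G : Type*) [Group G] extends CayleyFrame Γ G where
  /-- the propositional assignment -/
  val : I → Set G

namespace CayleyStructure

variable {Γ I G : Type*} [Group G] (M : CayleyStructure Γ I G)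

/-- The Kripke structure on `G` with the accessibility relations `R_α` for all sets of agents. -/
def toKripke : KripkeStructure (Set Γ) I G where
  rel := M.rel
  val := M.val

/-- `v ∼ w` within the Cayley structure `M`. -/
def Bisim (v w : G) : Prop :=
  M.toKripke.Bisimilar v M.toKripke w

/-- Every bisimulation type that is realised in an `α`-class, `α ≠ ∅`, is realised at least `k`
times in it. (The `∅`-classes are singletons and are exempt.) -/
def IsRich (k : ℕ) : Prop :=
  ∀ (α : Set Γ), α.Nonempty → ∀ w : G, (k : ℕ∞) ≤ {v ∈ M.cls α w | M.Bisim v w}.encard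

/-- `(m, k)`-freeness, a property of 2-acyclic Cayley structures. -/
def IsFree (m k : ℕ) : Prop :=
  M.IsAcyclic 2 ∧
    ∀ (v : G) (Z : Finset G) (z₀ : G), z₀ ∈ Z → Z.card ≤ k →
      ∀ γ : Set Γ, M.agt v z₀ ⊆ γ →
        ∃ v' : G, M.Bisim v' v ∧ M.agt v' z₀ = γ ∧ M.MFree m (Z : Set G) z₀ v'

end CayleyStructure

/-! If v* lies in [z₀]_γ, then t contains every class [z₀]_α with γ ⊆ α. A path of length at most m
outside t therefore gives a chain of at most m + 1 cosets from some z to v*, none of them such a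
class (`Reach`). It suffices to find v* ∼ v in [z₀]_γ that no such chain reaches
(`mFree_of_not_reach`).

Chains of length n + 1 are eliminated by induction on n. Once length n is excluded, v moves along
one agent a ∈ γ at a time, forcing a into the direction of the last coset of every chain of length n
+ 1. Richness offers k + 1 candidates in the a-class. If all failed, two would be reached from the
same z with last directions omitting a. The two chains and the a-edge form a closed chain of 2(n +
1) + 1 cosets, and acyclicity puts the a-edge inside an earlier coset, so v was reached in n steps
after all. When all of γ has been forced, the last coset is a forbidden class, so no chain remains.
-/

namespace KripkeStructure

variable {L I W V U : Type*}

theorem Bisimilar.refl (A : KripkeStructure L I W) (w : W) : A.Bisimilar w A w :=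
  ⟨Eq, ⟨by rintro w _ rfl i; rfl, by rintro w _ rfl l w' h; exact ⟨w', h, rfl⟩,
    by rintro w _ rfl l w' h; exact ⟨w', h, rfl⟩⟩, rfl⟩

theorem Bisimilar.trans {A : KripkeStructure L I W} {B : KripkeStructure L I V}
    {C : KripkeStructure L I U} {w : W} {v : V} {u : U}
    (h₁ : A.Bisimilar w B v) (h₂ : B.Bisimilar v C u) : A.Bisimilar w C u := by
  obtain ⟨Y, hY, hwv⟩ := h₁
  obtain ⟨Z, hZ, hvu⟩ := h₂
  refine ⟨fun x z => ∃ y, Y x y ∧ Z y z, ⟨?_, ?_, ?_⟩, v, hwv, hvu⟩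
  · rintro x z ⟨y, hxy, hyz⟩ i
    exact (hY.atom x y hxy i).trans (hZ.atom y z hyz i)
  · rintro x z ⟨y, hxy, hyz⟩ l x' hx
    obtain ⟨y', hy, hxy'⟩ := hY.forth x y hxy l x' hx
    obtain ⟨z', hz, hyz'⟩ := hZ.forth y z hyz l y' hy
    exact ⟨z', hz, y', hxy', hyz'⟩
  · rintro x z ⟨y, hxy, hyz⟩ l z' hz
    obtain ⟨y', hy, hyz'⟩ := hZ.back y z hyz l z' hz
    obtain ⟨x', hx, hxy'⟩ := hY.back x y hxy l y' hy
    exact ⟨x', hx, y', hxy', hyz'⟩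

end KripkeStructure

/-! ### Coset relations and closed chains -/

namespace CayleyFrame

variable {Γ G : Type*} [Group G] {F : CayleyFrame Γ G}

theorem rel_refl (α : Set Γ) (w : G) : F.rel α w w := by
  simp [rel, (F.subgroup α).one_mem]

theorem rel.symm {α : Set Γ} {w v : G} (h : F.rel α w v) : F.rel α v w := by
  simpa [rel] using (F.subgroup α).inv_mem h

theorem rel.trans {α : Set Γ} {w v u : G} (h : F.rel α w v) (h' : F.rel α v u) :
    F.rel α w u := by
  simpa [rel, mul_assoc] using (F.subgroup α).mul_mem h h'

theorem rel.mono {α β : Set Γ} {w v : G} (h : F.rel α w v) (hαβ : α ⊆ β) : F.rel β w v :=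
  Subgroup.closure_mono (Set.biUnion_subset_biUnion_left hαβ) h

theorem rel_empty_iff {w v : G} : F.rel ∅ w v ↔ w = v := by
  simp [rel, subgroup, inv_mul_eq_one]

theorem rel_inter_singleton {α : Set Γ} {a : Γ} (ha : a ∉ α) {w v : G}
    (h : F.rel (α ∩ {a}) w v) : w = v := by
  rw [Set.inter_singleton_eq_empty.2 ha] at h
  exact rel_empty_iff.1 h

theorem IsAcyclic.mono {m n : ℕ} (h : F.IsAcyclic n) (hmn : m ≤ n) : F.IsAcyclic m :=
  fun l hl => h l (hl.trans hmn)

theorem mk_eq_mk_iff_rel {α : Set Γ} {w v : G} :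
    (w : G ⧸ F.subgroup α) = v ↔ F.rel α w v := QuotientGroup.eq

theorem mk_mem_dualEdge {α : Set Γ} {c : G ⧸ F.subgroup α} {w : G} :
    (⟨α, c⟩ : F.DualVertex) ∈ F.dualEdge w ↔ (w : G ⧸ F.subgroup α) = c := by
  constructor
  · rintro ⟨β, h⟩
    obtain rfl : β = α := congrArg Sigma.fst h
    exact eq_of_heq (Sigma.mk.inj h).2
  · rintro rfl
    exact ⟨α, rfl⟩

/-- A closed chain of `l + 1` cosets that is not a coset cycle has a redundant link. -/
theorem IsAcyclic.exists_redundant {l : ℕ} (hF : F.IsAcyclic (l + 1)) (hl : 1 ≤ l)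
    (w : ℕ → G) (α : ℕ → Set Γ) (hw : ∀ i < l, F.rel (α i) (w i) (w (i + 1)))
    (hl0 : F.rel (α l) (w l) (w 0)) :
    ∃ i ≤ l, ∃ u, F.rel (α (if i = 0 then l else i - 1) ∩ α i) (w i) u ∧
      F.rel (α i ∩ α (if i = l then 0 else i + 1)) (w (if i = l then 0 else i + 1)) u := by
  by_contra! H
  have hsucc : ∀ i : Fin (l + 1), (i + 1).val = if i.val = l then 0 else i.val + 1 := by
    intro i
    simp [Fin.val_add_one, Fin.ext_iff]
  have hpred : ∀ i : Fin (l + 1), (i - 1).val = if i.val = 0 then l else i.val - 1 := by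
    intro i
    have h := hsucc (i - 1)
    have h' := (i - 1).isLt
    rw [sub_add_cancel] at h
    split_ifs at h ⊢ <;> omega
  -- `ZMod (l + 1)` unfolds to `Fin (l + 1)`, whose cyclic shifts are `hsucc` and `hpred`.
  refine hF (l + 1) le_rfl (fun i : Fin (l + 1) => w i.val) (fun i : Fin (l + 1) => α i.val)
    ⟨by omega, fun (i : Fin (l + 1)) => ?_, fun (i : Fin (l + 1)) => ?_⟩
  · have : F.rel (α i.val) (w i.val) (w (i + 1).val) := by
      rw [hsucc]
      split_ifs with h
      · rw [h]; exact hl0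
      · exact hw _ (by omega)
    exact this
  · have : F.cls (α (i - 1).val ∩ α i.val) (w i.val) ∩
        F.cls (α i.val ∩ α (i + 1).val) (w (i + 1).val) = ∅ := by
      rw [hsucc, hpred, Set.eq_empty_iff_forall_notMem]
      rintro u ⟨h₁, h₂⟩
      exact H i.val (by omega) u h₁ h₂
    exact this

/-- A short closed chain of cosets that passes through a non-trivial `a`-edge contains another
coset in which the two ends of that edge are linked by `a`. -/
theorem IsAcyclic.exists_mem_of_closed_chain (a : Γ) : ∀ (l : ℕ), F.IsAcyclic (l + 1) →
    1 ≤ l → F.IsAcyclic 2 → ∀ (w : ℕ → G) (α : ℕ → Set Γ),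
    (∀ i < l, F.rel (α i) (w i) (w (i + 1))) → F.rel {a} (w l) (w 0) → w l ≠ w 0 →
    ∃ i < l, a ∈ α i ∧ F.rel (α i) (w i) (w 0) := by
  intro l
  induction l with
  | zero => intro _ h; omega
  | succ l ih =>
  intro hF _ hF₂ w α hw hl0 hne
  by_contra! H
  have hlast : a ∉ α l := fun ha => H l (by omega) ha
    ((hw l (by omega)).trans (hl0.mono (by simpa using ha)))
  have hfirst : a ∉ α 0 := fun ha => H 0 (by omega) ha (rel_refl _ _)
  rcases Nat.eq_zero_or_pos l with rfl | hl
  · exact hne (rel_inter_singleton hfirst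
      (rel_inter_of_isAcyclic_two hF₂ (hw 0 (by omega)).symm hl0))
  set β : ℕ → Set Γ := fun i => if i = l + 1 then {a} else α i with hβ
  obtain ⟨i, hi, u, hu₁, hu₂⟩ := hF.exists_redundant (by omega) w β
    (fun i hi => by simpa [hβ, hi.ne] using hw i hi) (by simpa [hβ] using hl0)
  -- The a-link cannot be redundant: both neighbours omit a, so u would equal both of its distinct
  -- ends.
  by_cases hil : i = l + 1
  · subst hil
    have h₁ : F.rel (α l ∩ {a}) (w (l + 1)) u := by simpa [hβ] using hu₁
    have h₂ : F.rel (α 0 ∩ {a}) (w 0) u := by simpa [hβ, Set.inter_comm] using hu₂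
    exact hne ((rel_inter_singleton hlast h₁).trans (rel_inter_singleton hfirst h₂).symm)
  have hβi : β i = α i := by simp [hβ, hil]
  rw [if_neg hil, hβi] at hu₂
  rw [hβi] at hu₁
  -- Next to the a-link the intersection of directions is empty, so contracting there leaves the
  -- ends of the a-edge fixed.
  have hu0 : i = 0 → u = w 0 := by
    rintro rfl
    have : F.rel (α 0 ∩ {a}) (w 0) u := by simpa [hβ, Set.inter_comm] using hu₁
    exact (rel_inter_singleton hfirst this).symm
  have hul : i = l → u = w (l + 1) := by
    rintro rfl
    have : F.rel (α i ∩ {a}) (w (i + 1)) u := by simpa [hβ] using hu₂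
    exact (rel_inter_singleton hlast this).symm
  have hprev : ∀ j, j + 1 = i → F.rel (α j) (w j) u := by
    rintro j rfl
    have hj : j ≠ l + 1 := by omega
    have h : F.rel (α j ∩ α (j + 1)) (w (j + 1)) u := by
      simpa [hβ, hj] using hu₁
    exact (hw j (by omega)).trans (h.mono Set.inter_subset_left)
  have hnext : i < l → F.rel (α (i + 1)) u (w (i + 2)) := by
    intro h
    have h' : F.rel (α i ∩ α (i + 1)) (w (i + 1)) u := by
      simpa [hβ, h.ne] using hu₂
    exact (h'.mono Set.inter_subset_right).symm.trans (hw (i + 1) (by omega))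
  -- Link i is deleted, and u, which lies in both neighbouring cosets, replaces its two ends.
  set w' : ℕ → G := fun j => if j < i then w j else if j = i then u else w (j + 1) with hw'
  set α' : ℕ → Set Γ := fun j => if j < i then α j else α (j + 1) with hα'
  have h0 : w' 0 = w 0 := by
    by_cases h : i = 0
    · simp [hw', h, hu0 h]
    · simp [hw', Nat.pos_of_ne_zero h]
  have hl' : w' l = w (l + 1) := by
    by_cases h : i = l
    · simp [hw', h, hul h]
    · have h' : ¬ l < i := by omega
      simp [hw', h', Ne.symm h]
  have hlt : ∀ j < i, w' j = w j ∧ α' j = α j := fun j h => ⟨if_pos h, if_pos h⟩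
  have hself : w' i = u ∧ α' i = α (i + 1) := by simp [hw', hα']
  have hgt : ∀ j, i < j → w' j = w (j + 1) ∧ α' j = α (j + 1) := fun j h =>
    ⟨(if_neg (by omega)).trans (if_neg (by omega)), if_neg (by omega)⟩
  obtain ⟨j, hj, haj, hrj⟩ := ih (hF.mono (by omega)) hl hF₂ w' α' (by
    intro j hj
    rcases lt_trichotomy j i with h | h | h
    · rw [(hlt j h).1, (hlt j h).2]
      rcases lt_or_eq_of_le (Nat.succ_le_of_lt h) with h' | h'
      · rw [(hlt (j + 1) h').1]
        exact hw j (by omega)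
      · rw [Nat.succ_eq_add_one] at h'
        rw [h', hself.1]
        exact hprev j h'
    · rw [h, hself.1, hself.2, (hgt (i + 1) (by omega)).1]
      exact hnext (h ▸ hj)
    · rw [(hgt j h).1, (hgt j h).2, (hgt (j + 1) (by omega)).1]
      exact hw (j + 1) (by omega)) (by rwa [h0, hl']) (by rwa [h0, hl'])
  rw [h0] at hrj
  rcases lt_trichotomy j i with h | h | h
  · rw [(hlt j h).2] at haj
    rw [(hlt j h).1, (hlt j h).2] at hrj
    exact H j (by omega) haj hrj
  · subst h
    rw [hself.2] at haj
    rw [hself.1, hself.2] at hrj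
    exact H (j + 1) (by omega) haj ((hw (j + 1) (by omega)).trans ((hnext hj).symm.trans hrj))
  · rw [(hgt j h).2] at haj
    rw [(hgt j h).1, (hgt j h).2] at hrj
    exact H (j + 1) (by omega) haj hrj

/-! ### Chains avoiding the large classes of z₀ -/

variable (F) in
/-- The `α`-class of `w` is not one of the classes of `z₀` with `γ ⊆ α`. -/
def Avoids (z₀ : G) (γ α : Set Γ) (w : G) : Prop :=
  ¬ (γ ⊆ α ∧ F.rel α z₀ w)

theorem Avoids.of_rel {z₀ : G} {γ α : Set Γ} {w v : G} (h : F.Avoids z₀ γ α w)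
    (hwv : F.rel α w v) : F.Avoids z₀ γ α v :=
  fun h' => h ⟨h'.1, h'.2.trans hwv.symm⟩

theorem Avoids.not_subset {z₀ : G} {γ α : Set Γ} {w : G} (h : F.Avoids z₀ γ α w)
    (hw : F.rel γ z₀ w) : ¬ γ ⊆ α :=
  fun h' => h ⟨h', hw.mono h'⟩

theorem avoids_of_not_subset {z₀ : G} {γ α : Set Γ} {w : G} (h : ¬ γ ⊆ α) :
    F.Avoids z₀ γ α w :=
  fun h' => h h'.1

variable (F) in
/-- There is a chain of `n` cosets from `z` to the given world, none of which is a class of `z₀`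
of the form `[z₀]_α` with `γ ⊆ α`. -/
inductive Reach (z₀ : G) (γ : Set Γ) (z : G) : ℕ → G → Prop
  | zero : Reach z₀ γ z 0 z
  | succ {n : ℕ} {w v : G} {α : Set Γ} (h : Reach z₀ γ z n w) (hα : F.Avoids z₀ γ α w)
      (hwv : F.rel α w v) : Reach z₀ γ z (n + 1) v

namespace Reach

variable {z₀ z : G} {γ : Set Γ}

/-- Chains are padded with ∅-cosets, which are permitted because a non-empty γ is not contained in
∅. -/
theorem mono (hγ : γ.Nonempty) {m n : ℕ} (hmn : m ≤ n) {v : G} (h : F.Reach z₀ γ z m v) :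
    F.Reach z₀ γ z n v := by
  induction n, hmn using Nat.le_induction with
  | base => exact h
  | succ n _ ih =>
    exact ih.succ (avoids_of_not_subset (by simpa using hγ.ne_empty)) (rel_refl ∅ v)

theorem cons {y : G} {α : Set Γ} (hα : F.Avoids z₀ γ α y) (hyz : F.rel α y z) {n : ℕ} {v : G}
    (h : F.Reach z₀ γ z n v) : F.Reach z₀ γ y (n + 1) v := by
  induction h with
  | zero => exact .succ .zero hα hyz
  | succ _ hβ hwv ih => exact ih.succ hβ hwv

theorem exists_chain {n : ℕ} {v : G} (h : F.Reach z₀ γ z n v) :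
    ∃ (w : ℕ → G) (α : ℕ → Set Γ), w 0 = z ∧ w n = v ∧ (∀ i ≤ n, F.Reach z₀ γ z i (w i)) ∧
      ∀ i < n, F.Avoids z₀ γ (α i) (w i) ∧ F.rel (α i) (w i) (w (i + 1)) := by
  induction h with
  | zero =>
    exact ⟨fun _ => z, fun _ => ∅, rfl, rfl, by
      rintro i hi
      obtain rfl : i = 0 := by omega
      exact .zero, by intro i hi; omega⟩
  | @succ n w v α h hα hwv ih =>
    obtain ⟨x, β, hx0, hxn, hr, hs⟩ := ih
    refine ⟨fun i => if i ≤ n then x i else v, fun i => if i < n then β i else α, by simpa,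
      by simp, fun i hi => ?_, fun i hi => ?_⟩
    · by_cases h' : i ≤ n
      · simpa [h'] using hr i h'
      · obtain rfl : i = n + 1 := by omega
        simpa using h.succ hα hwv
    · by_cases h' : i < n
      · simpa [h', h'.le, Nat.succ_le_of_lt h'] using hs i h'
      · obtain rfl : i = n := by omega
        simpa [hxn] using ⟨hα, hwv⟩

end Reach

/-- If two distinct members of an `a`-class are reached by short chains from `z` with last
directions that do not contain `a`, then each member of the class is reached by a shorter chain. -/
theorem IsAcyclic.reach_of_reach_pair {n : ℕ} (hF : F.IsAcyclic (2 * (n + 1) + 1))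
    {z₀ z : G} {γ : Set Γ} (hγ : γ.Nonempty) {a : Γ} {v v₁ v₂ : G} (hne : v₁ ≠ v₂)
    (hv₁ : F.rel {a} v v₁) (hv₂ : F.rel {a} v v₂) {u₁ u₂ : G} {ε₁ ε₂ : Set Γ}
    (h₁ : F.Reach z₀ γ z n u₁) (hu₁ : F.rel ε₁ u₁ v₁) (ha₁ : a ∉ ε₁)
    (h₂ : F.Reach z₀ γ z n u₂) (hu₂ : F.rel ε₂ u₂ v₂) (ha₂ : a ∉ ε₂) :
    0 < n ∧ F.Reach z₀ γ z n v := by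
  obtain ⟨w₁, α₁, h10, h1n, hr₁, hs₁⟩ := h₁.exists_chain
  obtain ⟨w₂, α₂, h20, h2n, hr₂, hs₂⟩ := h₂.exists_chain
  -- A coset of either chain that contains v₁ and whose direction contains a also contains v.
  -- Stopping there takes i + 1 ≤ n steps.
  have key : ∀ (w : ℕ → G) (α : ℕ → Set Γ), (∀ i ≤ n, F.Reach z₀ γ z i (w i)) →
      (∀ i < n, F.Avoids z₀ γ (α i) (w i) ∧ F.rel (α i) (w i) (w (i + 1))) →
      ∀ i < n, a ∈ α i → F.rel (α i) (w i) v₁ → 0 < n ∧ F.Reach z₀ γ z n v := by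
    intro w α hr hs i hi ha hi'
    exact ⟨by omega, ((hr i hi.le).succ (hs i hi).1
      (hi'.trans (hv₁.symm.mono (by simpa using ha)))).mono hγ hi⟩
  -- the closed chain runs from `v₁` back to `z`, on to `v₂`, and returns through the `a`-class
  set w : ℕ → G := fun j => if j = 0 then v₁ else if j ≤ n + 1 then w₁ (n + 1 - j) else
    if j ≤ 2 * n + 1 then w₂ (j - (n + 1)) else v₂ with hw
  set α : ℕ → Set Γ := fun j => if j = 0 then ε₁ else if j ≤ n then α₁ (n - j) else
    if j ≤ 2 * n then α₂ (j - (n + 1)) else ε₂ with hα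
  have hw0 : w 0 = v₁ := by simp [hw]
  have hwl : w (2 * (n + 1)) = v₂ := by
    simp only [hw]
    rw [if_neg (by omega), if_neg (by omega), if_neg (by omega)]
  have hwn : w (n + 1) = z := by simp [hw, h10]
  have hwa : ∀ i ≤ n, w (i + 1) = w₁ (n - i) := by
    intro i hi
    simp [hw, hi]
  have hwb : ∀ i ≤ n, w (n + 1 + i) = w₂ i := by
    intro i hi
    rcases Nat.eq_zero_or_pos i with rfl | hi'
    · simp [hwn, h20]
    · simp only [hw]
      rw [if_neg (by omega), if_neg (by omega), if_pos (by omega)]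
      congr 1; omega
  have hαa : ∀ i < n, α (i + 1) = α₁ (n - 1 - i) := by
    intro i hi
    simp only [hα]
    rw [if_neg (by omega), if_pos (by omega)]
    congr 1; omega
  have hαb : ∀ i < n, α (n + 1 + i) = α₂ i := by
    intro i hi
    simp only [hα]
    rw [if_neg (by omega), if_neg (by omega), if_pos (by omega)]
    congr 1; omega
  have hα0 : α 0 = ε₁ := by simp [hα]
  have hαl : α (2 * n + 1) = ε₂ := by
    simp only [hα]
    rw [if_neg (by omega), if_neg (by omega), if_neg (by omega)]
  have hcases : ∀ i < 2 * (n + 1), i = 0 ∨ (∃ j < n, i = j + 1) ∨ (∃ j < n, i = n + 1 + j) ∨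
      i = 2 * n + 1 := by
    intro i hi
    by_cases h : i = 0
    · exact .inl h
    by_cases h' : i ≤ n
    · exact .inr (.inl ⟨i - 1, by omega, by omega⟩)
    by_cases h'' : i ≤ 2 * n
    · exact .inr (.inr (.inl ⟨i - (n + 1), by omega, by omega⟩))
    · exact .inr (.inr (.inr (by omega)))
  obtain ⟨i, hi, ha, hr⟩ := IsAcyclic.exists_mem_of_closed_chain a (2 * (n + 1)) hF (by omega)
    (hF.mono (by omega)) w α (by
      intro i hi
      rcases hcases i hi with rfl | ⟨j, hj, rfl⟩ | ⟨j, hj, rfl⟩ | rfl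
      · rw [hα0, hw0, hwa 0 (by omega), Nat.sub_zero, h1n]
        exact hu₁.symm
      · rw [hαa j hj, hwa j hj.le, hwa (j + 1) hj]
        have := (hs₁ (n - 1 - j) (by omega)).2.symm
        rw [(by omega : n - 1 - j + 1 = n - j)] at this
        rwa [(by omega : n - (j + 1) = n - 1 - j)]
      · rw [hαb j hj, hwb j hj.le, add_assoc, hwb (j + 1) hj]
        exact (hs₂ j hj).2
      · have := hwb n le_rfl
        rw [(by omega : n + 1 + n = 2 * n + 1), h2n] at this
        rw [hαl, this, (by omega : 2 * n + 1 + 1 = 2 * (n + 1)), hwl]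
        exact hu₂)
    (by rw [hwl, hw0]; exact hv₂.symm.trans hv₁) (by rw [hwl, hw0]; exact hne.symm)
  rw [hw0] at hr
  rcases hcases i hi with rfl | ⟨j, hj, rfl⟩ | ⟨j, hj, rfl⟩ | rfl
  · exact absurd (hα0 ▸ ha) ha₁
  · rw [hαa j hj] at ha hr
    rw [hwa j hj.le] at hr
    refine key w₁ α₁ hr₁ hs₁ (n - 1 - j) (by omega) ha ?_
    have := (hs₁ (n - 1 - j) (by omega)).2
    rw [(by omega : n - 1 - j + 1 = n - j)] at this
    exact this.trans hr
  · rw [hαb j hj] at ha hr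
    rw [hwb j hj.le] at hr
    exact key w₂ α₂ hr₂ hs₂ j hj ha hr
  · exact absurd (hαl ▸ ha) ha₂

/-! ### From unreachability to freeness -/

variable (F) in
/-- No chain of `n` cosets leads from `Z` to `v`, unless `n = 0`, and chains of `n + 1` cosets
arrive at `v` in a last step whose direction comprises `δ`. -/
def Remote (z₀ : G) (γ : Set Γ) (Z : Set G) (n : ℕ) (δ : Set Γ) (v : G) : Prop :=
  ∀ z ∈ Z, (0 < n → ¬ F.Reach z₀ γ z n v) ∧
    ∀ u α, F.Reach z₀ γ z n u → F.Avoids z₀ γ α u → F.rel α u v → δ ⊆ α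

/-- A last direction comprising γ would make the last coset a class [z₀]_α with γ ⊆ α, which is
forbidden. -/
theorem Remote.not_reach {z₀ : G} {γ : Set Γ} {Z : Set G} {n : ℕ} {v : G}
    (h : F.Remote z₀ γ Z n γ v) (hv : F.rel γ z₀ v) {z : G} (hz : z ∈ Z) :
    ¬ F.Reach z₀ γ z (n + 1) v := by
  rintro (_ | ⟨hu, hα, huv⟩)
  exact (hα.of_rel huv).not_subset hv ((h z hz).2 _ _ hu hα huv)

theorem mFree_of_not_reach {m : ℕ} {z₀ v : G} {γ : Set Γ} {Z : Set G} (hv : F.rel γ z₀ v)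
    (h : ∀ z ∈ Z, ¬ F.Reach z₀ γ z (m + 1) v) (hγ : γ.Nonempty) : F.MFree m Z z₀ v := by
  set t := F.dualEdge v ∩ F.dualEdge z₀ with ht
  have avoids : ∀ (α : Set Γ) (w : G),
      (⟨α, (w : G ⧸ F.subgroup α)⟩ : F.DualVertex) ∉ t → F.Avoids z₀ γ α w := by
    rintro α w hw ⟨hγα, hα⟩
    exact hw ⟨mk_mem_dualEdge.2 (mk_eq_mk_iff_rel.2 ((hv.mono hγα).symm.trans hα)),
      mk_mem_dualEdge.2 (mk_eq_mk_iff_rel.2 hα)⟩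
  -- Vertices of the path are cosets and its edges supply the worlds between them, so a path of
  -- length p uses p + 1 cosets.
  have reach : ∀ (x y : F.DualVertex) (p : (F.dual.deleteVertices t).gaifman.Walk x y),
      x ∉ t → y ∈ F.dualEdge v → ∀ z, x ∈ F.dualEdge z →
        F.Reach z₀ γ z (p.length + 1) v := by
    intro x y p
    induction p with
    | nil =>
      rintro hx hy z ⟨α, rfl⟩
      exact .succ .zero (avoids α z hx) (mk_eq_mk_iff_rel.1 (mk_mem_dualEdge.1 hy)).symm
    | cons hadj p ih =>
      rintro hx hy z ⟨α, rfl⟩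
      obtain ⟨-, e, ⟨_, ⟨w, rfl⟩, rfl⟩, hxe, hye⟩ := hadj
      exact (ih hye.2 hy w hye.1).cons (avoids α z hx)
        (mk_eq_mk_iff_rel.1 (mk_mem_dualEdge.1 hxe.1)).symm
  have hle : ((m + 1 : ℕ) : ℕ∞) ≤ F.dual.distAvoiding t (⋃ z ∈ Z, F.dualEdge z)
      (F.dualEdge v) := by
    refine le_iInf₂ fun x hx => le_iInf₂ fun y hy => ?_
    by_contra! hlt
    obtain ⟨p, hp⟩ := SimpleGraph.exists_walk_of_edist_ne_top (ne_top_of_lt hlt)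
    obtain ⟨z, hz, hxz⟩ := Set.mem_iUnion₂.1 hx.1
    rw [← hp, Nat.cast_lt] at hlt
    exact h z hz ((reach x y p hx.2 hy.1 z hxz).mono hγ hlt)
  exact lt_of_lt_of_le (by exact_mod_cast Nat.lt_succ_self m) hle

/-- Here t is all of ⟦z₀⟧, so the infimum is over an empty set. -/
theorem mFree_self (m : ℕ) (Z : Set G) (z₀ : G) : F.MFree m Z z₀ z₀ := by
  simp [MFree, Hypergraph.distAvoiding]

theorem IsAcyclic.rel_agt [Finite Γ] (hF : F.IsAcyclic 2) (w v : G) :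
    F.rel (F.agt w v) w v :=
  (isLeast_agt hF w v).1

end CayleyFrame

/-! ### Choosing bisimilar worlds by richness -/

namespace CayleyStructure

open CayleyFrame

variable {Γ I G : Type*} [Group G] {M : CayleyStructure Γ I G}

theorem Bisim.trans {u v w : G} (h₁ : M.Bisim u v) (h₂ : M.Bisim v w) : M.Bisim u w :=
  KripkeStructure.Bisimilar.trans h₁ h₂

theorem Bisim.refl (w : G) : M.Bisim w w := KripkeStructure.Bisimilar.refl _ w

/-- A move inside an `a`-class to a bisimilar world that adds `a` to the last directions. -/
theorem IsRich.exists_remote_insert {n k : ℕ} (hF : M.IsAcyclic (2 * (n + 1) + 1))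
    (hM : M.IsRich (k + 1)) {z₀ v : G} {γ δ : Set Γ} {Z : Finset G} (hZ : Z.card ≤ k) {a : Γ}
    (ha : a ∈ γ) (hv : M.Remote z₀ γ Z n δ v) :
    ∃ v', M.rel {a} v v' ∧ M.Bisim v' v ∧ M.Remote z₀ γ Z n (insert a δ) v' := by
  have hγ : γ.Nonempty := ⟨a, ha⟩
  by_contra! H
  have bad : ∀ v' ∈ {v' ∈ M.cls {a} v | M.Bisim v' v}, ∃ z ∈ Z, ∃ u ε,
      M.Reach z₀ γ z n u ∧ M.rel ε u v' ∧ a ∉ ε := by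
    rintro v' ⟨hv', hb⟩
    have := H v' hv' hb
    simp only [Remote, not_forall, not_and_or, not_not] at this
    obtain ⟨z, hz, ⟨hn, hr⟩ | ⟨u, ε, hu, hε, huv, hsub⟩⟩ := this
    -- A world already reached in n steps counts as reached by a trivial last step in direction ∅,
    -- which omits a.
    · exact ⟨z, hz, v', ∅, hr, rel_refl _ _, Set.notMem_empty a⟩
    · refine ⟨z, hz, u, ε, hu, huv, fun haε => hsub (Set.insert_subset haε ?_)⟩
      -- If a ∈ ε, the same last coset arrives at v, so δ ⊆ ε is inherited.
      exact (hv z hz).2 u ε hu hε (huv.trans (rel.symm hv' |>.mono (by simpa using haε)))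
  choose! f hfZ hf using bad
  have hcard : (Z : Set G).encard < {v' ∈ M.cls {a} v | M.Bisim v' v}.encard := by
    refine lt_of_lt_of_le ?_ (hM {a} (Set.singleton_nonempty a) v)
    rw [Set.encard_coe_eq_coe_finsetCard]
    exact_mod_cast Nat.lt_succ_of_le hZ
  -- With more candidates than elements of Z, two share the same z.
  obtain ⟨v₁, hv₁, v₂, hv₂, hne, heq⟩ :=
    Set.exists_ne_map_eq_of_encard_lt_of_maps_to hcard (f := f) hfZ
  obtain ⟨u₁, ε₁, hu₁, hr₁, ha₁⟩ := hf v₁ hv₁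
  obtain ⟨u₂, ε₂, hu₂, hr₂, ha₂⟩ := hf v₂ hv₂
  obtain ⟨hn, hr⟩ := hF.reach_of_reach_pair hγ hne hv₁.1 hv₂.1 hu₁ hr₁ ha₁ (heq ▸ hu₂) hr₂ ha₂
  exact (hv _ (hfZ v₁ hv₁)).1 hn hr

theorem IsRich.exists_remote [Finite Γ] {n k : ℕ} (hF : M.IsAcyclic (2 * (n + 1) + 1))
    (hM : M.IsRich (k + 1)) {z₀ v : G} {γ : Set Γ} {Z : Finset G} (hZ : Z.card ≤ k)
    (hv : M.Remote z₀ γ Z n ∅ v) :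
    ∃ v', M.rel γ v v' ∧ M.Bisim v' v ∧ M.Remote z₀ γ Z n γ v' := by
  have : ∀ δ : Set Γ, δ ⊆ γ → ∃ v', M.rel γ v v' ∧ M.Bisim v' v ∧ M.Remote z₀ γ Z n δ v' := by
    intro δ
    induction δ, δ.toFinite using Set.Finite.induction_on with
    | empty => exact fun _ => ⟨v, rel_refl _ _, Bisim.refl v, hv⟩
    | insert _ _ ih =>
      intro h
      obtain ⟨v', hr, hb, hv'⟩ := ih ((Set.subset_insert _ _).trans h)
      obtain ⟨v'', hr', hb', hv''⟩ := hM.exists_remote_insert hF hZ (h (Set.mem_insert _ _)) hv'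
      exact ⟨v'', hr.trans (hr'.mono (by simpa using h (Set.mem_insert _ _))), hb'.trans hb,
        hv''⟩
  exact this γ subset_rfl

/-- Unreachability in n steps is exactly what `Remote` demands with δ = ∅; for n = 0 it demands
nothing. -/
theorem IsRich.exists_not_reach [Finite Γ] {k : ℕ} (hM : M.IsRich (k + 1)) {z₀ v : G}
    {γ : Set Γ} {Z : Finset G} (hZ : Z.card ≤ k) (hv : M.rel γ z₀ v) :
    ∀ n : ℕ, M.IsAcyclic (2 * (n + 1) + 1) →
      ∃ v', M.rel γ z₀ v' ∧ M.Bisim v' v ∧ ∀ z ∈ Z, ¬ M.Reach z₀ γ z (n + 1) v' := by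
  have step : ∀ n, M.IsAcyclic (2 * (n + 1) + 1) → ∀ v, M.rel γ z₀ v →
      M.Remote z₀ γ Z n ∅ v →
      ∃ v', M.rel γ z₀ v' ∧ M.Bisim v' v ∧ ∀ z ∈ Z, ¬ M.Reach z₀ γ z (n + 1) v' := by
    intro n hF v hv h
    obtain ⟨v', hr, hb, hv'⟩ := hM.exists_remote hF hZ h
    exact ⟨v', hv.trans hr, hb, fun z hz => hv'.not_reach (hv.trans hr) hz⟩
  intro n
  induction n with
  | zero =>
    exact fun hF => step 0 hF v hv fun z _ => ⟨fun h => absurd h (lt_irrefl 0),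
      fun _ _ _ _ _ => Set.empty_subset _⟩
  | succ n ih =>
    intro hF
    obtain ⟨v', hv', hb, hr⟩ := ih (hF.mono (by omega))
    obtain ⟨v'', hv'', hb', hr'⟩ := step (n + 1) hF v' hv' fun z hz => ⟨fun _ => hr z hz,
      fun _ _ _ _ _ => Set.empty_subset _⟩
    exact ⟨v'', hv'', hb'.trans hb, hr'⟩

end CayleyStructure

open CayleyFrame CayleyStructure in
theorem theorem3p29 (m k : ℕ) :
    ∃ N K : ℕ, ∀ (Γ : Type*) [Finite Γ] (I : Type*) (G : Type*) [Group G]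
      (M : CayleyStructure Γ I G),
      M.IsAcyclic N → M.IsRich K → M.IsFree m k := by
  -- Two chains of m + 1 cosets plus one a-edge; one candidate more than the size of Z.
  refine ⟨2 * (m + 1) + 1, k + 1, ?_⟩
  intro Γ _ I G _ M hF hM
  have hF₂ : M.IsAcyclic 2 := hF.mono (by omega)
  refine ⟨hF₂, fun v Z z₀ hz₀ hZ γ hγ => ?_⟩
  have hv : M.rel γ v z₀ := (hF₂.rel_agt v z₀).mono hγ
  rcases γ.eq_empty_or_nonempty with rfl | hne
  · obtain rfl : v = z₀ := rel_empty_iff.1 hv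
    have hagt : M.agt v v = ∅ := Set.eq_empty_of_subset_empty hγ
    have hfree : M.MFree m (Z : Set G) v v := mFree_self m (Z : Set G) v
    exact ⟨v, Bisim.refl v, hagt, hfree⟩
  obtain ⟨v', hv', hb, hr⟩ := hM.exists_not_reach hZ hv.symm m hF
  have hsub : M.agt v' z₀ ⊆ γ := (isLeast_agt hF₂ v' z₀).2 hv'.symm
  refine ⟨v', hb, hsub.antisymm ?_, mFree_of_not_reach hv' hr hne⟩
  -- Otherwise the single coset of direction agt(v', z₀) is an admissible chain from z₀ to v'.
  by_contra hnot
  exact hr z₀ hz₀ ((Reach.succ .zero (avoids_of_not_subset hnot)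
    (hF₂.rel_agt v' z₀).symm).mono hne (by omega))
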